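/- Let $\mathcal X\subset\mathbb R^d$ be any set and let $\xi\sim GP(\mu,\mathcal K)$ be a real Gaussian process indexed by $\mathcal X$, with arbitrary mean function $\mu$ and continuous covariance function $\mathcal K$. Assume that the covariance is stationary, $\mathcal K(x,y)=k(x-y)$ for $x,y\in\mathcal X$, where $k:\mathbb R^d\to\mathbb R$ has a spectral density $\mathcal S$: $\mathcal S\ge 0$ a.e., $\mathcal S\in L^1(\mathbb R^d)$ and $$k(h)=\int_{\mathbb R^d}\mathcal S(\omega)\,e^{i\langle\omega,h\rangle}\,d\omega\qquad(h\in\mathbb R^d).$$ Assume that $\mathcal S^{-1}$ has at most polynomial growth: there are $C\in\mathbb R$ and $r\in\mathbb N$ with $\mathcal S(\omega)>0$ and $\mathcal S(\omega)^{-1}\le C(1+\|\omega\|)^r$ for almost every $\omega$. For a data set $D\subset\mathcal X\times\mathbb R$ with finite set $T\subset\mathcal X$ of input points, the posterior variance of the process at $x\in\mathcal X$ is $$\hat\sigma^2(x;D)=\mathcal K(x,x)-\mathcal K(x,T)\,\mathcal K(T,T)^{-1}\,\mathcal K(T,x);$$ if $D$ has infinitely many input points, $\hat\sigma^2(x;D)$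 is the infimum of this expression over all finite subsets $T$ of the set of input points. Write $E_f(S)=\{(x,f(x)):x\in S\}$ and $\Delta(x,S)=\inf_{y\in S}\|x-y\|$. Then, for every realization $f$ of $\xi$, the posterior variance has the generalized no-empty-ball (GNEB) property: 1. For every $x\in\mathcal X$, every sequence $(x_n)_{n\ge1}$ in $\mathcal X$ and every sequence $(S_n)_{n\ge 1}$ of subsets of $\mathcal X$, with $X_n=\{x_1,\dots,x_n\}$: if $\inf_{n\ge1}\Delta(x,S_n\cup X_n)>0$, then $\liminf_{n\to\infty}\hat\sigma^2\bigl(x;E_f(S_n)\cup E_f(X_n)\bigr)>0$. 2. For every sequence $(x_n)_{n\ge1}$ in $\mathcal X$ that converges to a point of $\mathcal X$ and every sequence $(S_n)_{n\ge 1}$ of subsets of $\mathcal X$, $\hat\sigma^2\bigl(x_n;E_f(S_{n-1})\cup E_f(X_{n-1})\bigr)\to0$ as $n\to\infty$. -/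

import Mathlib

open MeasureTheory ProbabilityTheory Filter Topology

noncomputable section

namespace PseudoBO

/-- The set `E_f(S) = {(x, f x) : x ∈ S}` of evaluated pairs. -/
def evalPairs {𝒳 : Type*} (f : 𝒳 → ℝ) (S : Set 𝒳) : Set (𝒳 × ℝ) :=
  (fun x => (x, f x)) '' S

/-- The input points of a data set. -/
def inputs {𝒳 : Type*} (D : Set (𝒳 × ℝ)) : Set 𝒳 :=
  Prod.fst '' D

/-- The generalized no-empty-ball property of an uncertainty quantifier `σ`, which assigns to a
point `x` and a data set `D` the number `σ x D`; the data are evaluations of `f`.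

Sequences are indexed from `0`, so the value of `x` (resp. `S`) at `n` is the `(n+1)`-st term of
the sequence and `x '' Set.Iic n` is the (never empty) set of the first `n + 1` points.
The lower limit is taken in the extended reals. -/
structure IsGNEB {𝒳 : Type*} [PseudoMetricSpace 𝒳] (f : 𝒳 → ℝ)
    (σ : 𝒳 → Set (𝒳 × ℝ) → ℝ) : Prop where
  /-- Positive uncertainty away from the data. -/
  pos_away : ∀ (z : 𝒳) (x : ℕ → 𝒳) (S : ℕ → Set 𝒳),
    0 < ⨅ n, Metric.infDist z (S n ∪ x '' Set.Iic n) →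
    (0 : EReal) < liminf
      (fun n => ((σ z (evalPairs f (S n) ∪ evalPairs f (x '' Set.Iic n)) : ℝ) : EReal)) atTop
  /-- Vanishing uncertainty along convergent query sequences. -/
  vanish : ∀ (x : ℕ → 𝒳) (x' : 𝒳) (S : ℕ → Set 𝒳), Tendsto x atTop (𝓝 x') →
    Tendsto (fun n => σ (x (n + 1)) (evalPairs f (S n) ∪ evalPairs f (x '' Set.Iic n)))
      atTop (𝓝 0)

/-- `ξ ∼ GP(m, K)`: the family `ξ` is a Gaussian process on the index set `𝒳` with mean function
`m` and covariance function `K`. -/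
structure IsGP {𝒳 Ω : Type*} [MeasurableSpace Ω] (ξ : 𝒳 → Ω → ℝ) (m : 𝒳 → ℝ)
    (K : 𝒳 → 𝒳 → ℝ) (P : Measure Ω) : Prop where
  gaussian : IsGaussianProcess ξ P
  mean : ∀ x, ∫ ω, ξ x ω ∂P = m x
  covariance : ∀ x y, cov[ξ x, ξ y; P] = K x y

open Classical in
/-- Posterior variance at `x` given evaluations at the finitely many distinct points of `T`:
`K(x, x) - K(x, T) K(T, T)⁻¹ K(T, x)`. -/
def posteriorVarianceFinset {𝒳 : Type*} (K : 𝒳 → 𝒳 → ℝ) (x : 𝒳) (T : Finset 𝒳) : ℝ :=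
  K x x - (fun i : T => K x i) ⬝ᵥ
    ((Matrix.of fun i j : T => K i j)⁻¹).mulVec (fun i : T => K i x)

open Classical in
/-- Posterior variance at `x` of a Gaussian process with covariance function `K`, given the data
set `D`. It does not depend on the labels. If there are infinitely many input points, it is the
infimum of the posterior variances over their finite subsets, that is, the limit along the
increasing net of finite subsets. -/
def posteriorVariance {𝒳 : Type*} (K : 𝒳 → 𝒳 → ℝ) (x : 𝒳) (D : Set (𝒳 × ℝ)) : ℝ :=
  if h : (inputs D).Finite then posteriorVarianceFinset K x h.toFinset
  else ⨅ T : {T : Finset 𝒳 // (T : Set 𝒳) ⊆ inputs D}, posteriorVarianceFinset K x T.1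

/-- `s` is a spectral density of the stationary covariance `k`:
`k(h) = ∫ s(w) exp(i⟨w, h⟩) dw` with `s` nonnegative and integrable. -/
structure IsSpectralDensity {d : ℕ} (k s : EuclideanSpace ℝ (Fin d) → ℝ) : Prop where
  nonneg : ∀ᵐ w, 0 ≤ s w
  integrable : Integrable s
  fourier : ∀ h, (k h : ℂ) = ∫ w, (s w : ℂ) * Complex.exp (Complex.I * (inner ℝ w h : ℝ))

/-- `1 / s` is (almost everywhere) finite and bounded by a polynomial. -/
def InvPolynomialGrowth {d : ℕ} (s : EuclideanSpace ℝ (Fin d) → ℝ) : Prop :=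
  ∃ (C : ℝ) (r : ℕ), ∀ᵐ w, 0 < s w ∧ (s w)⁻¹ ≤ C * (1 + ‖w‖) ^ r

end PseudoBO

end

/-! The posterior variance at `z` is the least variance of `ξ z - ∑ c t * ξ t`. Spectrally this
variance is `∫ s * |u|²`, where `u` is a sum of characters with coefficient `1` at `z`. If the data
stay at distance `ρ` from `z`, take a Schwartz `ψ` whose transform is `1` at `0` and vanishes beyond
radius `ρ`: pairing `u`, recentred at `z`, with `ψ` returns the coefficient `1`. Cauchy–Schwarz with
weight `s` gives `1 ≤ ∫ s * |u|² * ∫ |ψ|² / s`, whose last factor is finite by polynomial growth and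
independent of the data (`exists_mul_sq_le_sum_sum`). For vanishing, predict from the preceding
query point alone and use continuity of `K`. -/

namespace PseudoBO

open scoped FourierTransform

/-! ### Spectral lower bound for quadratic forms -/

section Spectral

variable {d : ℕ}

local notation "𝔼" => EuclideanSpace ℝ (Fin d)

/-- The character `w ↦ exp(i⟨w, h⟩)`. -/
noncomputable def character (h w : 𝔼) : ℂ :=
  Complex.exp (Complex.I * (inner ℝ w h : ℝ))

lemma norm_character (h w : 𝔼) : ‖character h w‖ = 1 := by
  rw [character, mul_comm, Complex.norm_exp_ofReal_mul_I]

lemma continuous_character (h : 𝔼) : Continuous (character h) := by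
  unfold character
  fun_prop

lemma character_sub (x y w : 𝔼) :
    character (x - y) w = character x w * (starRingEnd ℂ) (character y w) := by
  simp only [character, ← Complex.exp_conj, ← Complex.exp_add, inner_sub_right, map_mul,
    Complex.conj_I, Complex.conj_ofReal]
  congr 1
  push_cast
  ring

/-- Translating all nodes multiplies the sum by a unimodular factor. -/
lemma norm_sum_character_sub {ι : Type*} [Fintype ι] (a : ι → 𝔼) (b : ι → ℝ) (z w : 𝔼) :
    ‖∑ i, (b i : ℂ) * character (a i - z) w‖ = ‖∑ i, (b i : ℂ) * character (a i) w‖ := by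
  simp only [character_sub, ← mul_assoc, ← Finset.sum_mul, norm_mul, RCLike.norm_conj,
    norm_character, mul_one]

lemma continuous_sum_character {ι : Type*} [Fintype ι] (a : ι → 𝔼) (b : ι → ℝ) :
    Continuous fun w => ∑ i, (b i : ℂ) * character (a i) w :=
  continuous_finsetSum _ fun i _ => continuous_const.mul (continuous_character (a i))

lemma norm_sum_character_le {ι : Type*} [Fintype ι] (a : ι → 𝔼) (b : ι → ℝ) (w : 𝔼) :
    ‖∑ i, (b i : ℂ) * character (a i) w‖ ≤ ∑ i, |b i| :=
  (norm_sum_le _ _).trans_eq (by simp [norm_character])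

lemma integrable_mul_normSq_sum_character {s : 𝔼 → ℝ} (hs : Integrable s)
    {ι : Type*} [Fintype ι] (a : ι → 𝔼) (b : ι → ℝ) :
    Integrable fun w => s w * ‖∑ i, (b i : ℂ) * character (a i) w‖ ^ 2 := by
  refine hs.mul_bdd (c := (∑ i, |b i|) ^ 2)
    ((continuous_sum_character a b).norm.pow 2).aestronglyMeasurable (.of_forall fun w => ?_)
  rw [norm_pow, norm_norm]
  exact pow_le_pow_left₀ (norm_nonneg _) (norm_sum_character_le a b w) 2

/-- The quadratic form of a stationary covariance is an integral against its spectral density. -/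
lemma IsSpectralDensity.sum_sum_eq_integral {k s : 𝔼 → ℝ} (hs : IsSpectralDensity k s)
    {ι : Type*} [Fintype ι] (a : ι → 𝔼) (b : ι → ℝ) :
    ∑ i, ∑ j, b i * b j * k (a i - a j)
      = ∫ w, s w * ‖∑ i, (b i : ℂ) * character (a i) w‖ ^ 2 := by
  have hint (i j : ι) :
      Integrable fun w => (b i : ℂ) * b j * ((s w : ℂ) * character (a i - a j) w) :=
    (hs.integrable.ofReal.mul_bdd (c := 1) (continuous_character _).aestronglyMeasurable
      (.of_forall fun w => (norm_character _ _).le)).const_mul _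
  apply Complex.ofReal_injective
  rw [← integral_complex_ofReal]
  push_cast
  simp_rw [hs.fourier, ← integral_const_mul]
  change ∑ i, ∑ j, ∫ w, (b i : ℂ) * b j * ((s w : ℂ) * character (a i - a j) w) = _
  simp_rw [← integral_finsetSum Finset.univ fun j _ => hint _ j]
  rw [← integral_finsetSum _ fun i _ => integrable_finsetSum _ fun j _ => hint i j]
  refine integral_congr_ae (.of_forall fun w => ?_)
  simp only
  rw [← Complex.mul_conj', map_sum, Finset.sum_mul_sum, Finset.mul_sum]
  refine Finset.sum_congr rfl fun i _ => ?_
  rw [Finset.mul_sum]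
  refine Finset.sum_congr rfl fun j _ => ?_
  rw [character_sub, map_mul, Complex.conj_ofReal]
  ring

/-- Makes `∫ |ψ|² / s` finite: one factor `‖ψ w‖` is bounded, the other absorbs the polynomial. -/
lemma SchwartzMap.integrable_one_add_norm_pow_mul_sq (ψ : SchwartzMap 𝔼 ℂ) (r : ℕ) :
    Integrable fun w => (1 + ‖w‖) ^ r * ‖ψ w‖ ^ 2 := by
  obtain ⟨B, hB⟩ := ψ.decay 0 0
  have hB' (w : 𝔼) : ‖ψ w‖ ≤ B := by simpa using hB.2 w
  have h := (((ψ.integrable_pow_mul volume 0).add (ψ.integrable_pow_mul volume r)).const_mul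
    ((2 : ℝ) ^ (r - 1))).mul_const B
  refine h.mono' (by have := ψ.continuous; fun_prop) (.of_forall fun w => ?_)
  rw [Real.norm_of_nonneg (by positivity)]
  have h1 := add_pow_le zero_le_one (norm_nonneg w) r
  rw [one_pow] at h1
  calc (1 + ‖w‖) ^ r * ‖ψ w‖ ^ 2 = (1 + ‖w‖) ^ r * ‖ψ w‖ * ‖ψ w‖ := by ring
    _ ≤ (2 ^ (r - 1) * (1 + ‖w‖ ^ r)) * ‖ψ w‖ * B := by
        gcongr
        exact hB' w
    _ = _ := by simp only [Pi.add_apply]; ring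

/-- A function that is `1` at the origin and vanishes outside the ball of radius `ρ`, as a
superposition of characters with a rapidly decreasing density. -/
lemma exists_schwartzMap_integral_character {ρ : ℝ} (hρ : 0 < ρ) :
    ∃ ψ : SchwartzMap 𝔼 ℂ, ∫ w, ψ w * character 0 w = 1 ∧
      ∀ h : 𝔼, ρ ≤ ‖h‖ → ∫ w, ψ w * character h w = 0 := by
  have hπ : 0 < 2 * Real.pi := by positivity
  -- The Fourier kernel of Mathlib carries `2π`, so `character h` corresponds to evaluation at `h /
  -- (2π)`.
  let β : ContDiffBump (0 : 𝔼) :=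
    ⟨ρ / (2 * Real.pi) / 2, ρ / (2 * Real.pi), by positivity, half_lt_self (by positivity)⟩
  have hsupp : HasCompactSupport fun x : 𝔼 => (β x : ℂ) :=
    β.hasCompactSupport.comp_left (g := fun t : ℝ => (t : ℂ)) Complex.ofReal_zero
  let φ : SchwartzMap 𝔼 ℂ :=
    hsupp.toSchwartzMap (Complex.ofRealCLM.contDiff.comp β.contDiff)
  have key (h : 𝔼) : ∫ w, (𝓕 φ) w * character h w = β ((2 * Real.pi)⁻¹ • h) := by
    have h1 : 𝓕⁻ (𝓕 φ) ((2 * Real.pi)⁻¹ • h) = φ ((2 * Real.pi)⁻¹ • h) := by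
      rw [FourierTransform.fourierInv_fourier_eq]
    rw [SchwartzMap.fourierInv_coe, Real.fourierInv_eq'] at h1
    refine Eq.trans (integral_congr_ae (.of_forall fun w => ?_)) h1
    simp only [character, smul_eq_mul, inner_smul_right]
    rw [mul_comm, mul_inv_cancel_left₀ hπ.ne', mul_comm Complex.I]
  refine ⟨𝓕 φ, ?_, fun h hh => ?_⟩
  · rw [key, smul_zero, β.one_of_mem_closedBall (by simpa using β.rIn_pos.le), Complex.ofReal_one]
  · rw [key, β.zero_of_le_dist, Complex.ofReal_zero]
    rw [dist_zero_right, norm_smul, norm_inv, Real.norm_of_nonneg hπ.le, inv_mul_eq_div]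
    exact div_le_div_of_nonneg_right hh hπ.le

/-- Pointwise Young inequality; once integrated it replaces the weighted Cauchy–Schwarz inequality.
-/
lemma two_mul_abs_mul_le {M σ p q g : ℝ} (hM : 0 < M) (hσ : 0 < σ) (β : ℝ)
    (hg : σ⁻¹ * p ^ 2 ≤ g) :
    2 * |β| * (p * q) ≤ M * (σ * q ^ 2) + β ^ 2 / M * g := by
  have hsq : 0 ≤ (M * σ)⁻¹ * (M * σ * q - |β| * p) ^ 2 := by positivity
  have hexp : (M * σ)⁻¹ * (M * σ * q - |β| * p) ^ 2
      = M * (σ * q ^ 2) + β ^ 2 / M * (σ⁻¹ * p ^ 2) - 2 * |β| * (p * q) := by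
    rw [← sq_abs β]
    field_simp
    ring
  have := mul_le_mul_of_nonneg_left hg (show 0 ≤ β ^ 2 / M by positivity)
  linarith

/-- The quadratic form dominates the square of a coefficient whose point is separated from all
others, uniformly in the number and the position of the points. -/
lemma IsSpectralDensity.exists_mul_sq_le_sum_sum {k s : 𝔼 → ℝ} (hs : IsSpectralDensity k s)
    (hgrowth : InvPolynomialGrowth s) {ρ : ℝ} (hρ : 0 < ρ) :
    ∃ δ > 0, ∀ (ι : Type) [Fintype ι] (a : ι → 𝔼) (b : ι → ℝ) (i₀ : ι),
      (∀ i, i ≠ i₀ → ρ ≤ dist (a i) (a i₀)) →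
        δ * b i₀ ^ 2 ≤ ∑ i, ∑ j, b i * b j * k (a i - a j) := by
  obtain ⟨C, r, hC⟩ := hgrowth
  obtain ⟨ψ, hψ1, hψ0⟩ := exists_schwartzMap_integral_character (d := d) hρ
  have hG := (SchwartzMap.integrable_one_add_norm_pow_mul_sq ψ r).const_mul C
  set G : 𝔼 → ℝ := fun w => C * ((1 + ‖w‖) ^ r * ‖ψ w‖ ^ 2) with hGdef
  -- Adding `1` gives `M > 0` and `∫ G ≤ M` at once.
  set M : ℝ := |∫ w, G w| + 1
  have hM : 0 < M := by positivity
  refine ⟨M⁻¹, inv_pos.2 hM, fun ι _ a b i₀ hsep => ?_⟩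
  rw [hs.sum_sum_eq_integral]
  set u : 𝔼 → ℂ := fun w => ∑ i, (b i : ℂ) * character (a i) w with hu
  have hQ := integrable_mul_normSq_sum_character hs.integrable a b
  have hψint (h : 𝔼) : Integrable fun w => ψ w * character h w :=
    ψ.integrable.mul_bdd (c := 1) (continuous_character _).aestronglyMeasurable
      (.of_forall fun w => (norm_character _ _).le)
  -- After recentring at `a i₀`, every other node lies where the transform of `ψ` vanishes.
  have hval : ∫ w, ψ w * ∑ i, (b i : ℂ) * character (a i - a i₀) w = b i₀ := by
    have h1 (w : 𝔼) : ψ w * ∑ i, (b i : ℂ) * character (a i - a i₀) w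
        = ∑ i, (b i : ℂ) * (ψ w * character (a i - a i₀) w) := by
      rw [Finset.mul_sum]
      exact Finset.sum_congr rfl fun i _ => by ring
    simp_rw [h1]
    rw [integral_finsetSum _ fun i _ => (hψint _).const_mul _]
    simp_rw [integral_const_mul]
    rw [Finset.sum_eq_single i₀ (fun i _ hi => ?_) (by simp), sub_self, hψ1, mul_one]
    rw [hψ0 _ (by rw [← dist_eq_norm]; exact hsep i hi), mul_zero]
  have hle : |b i₀| ≤ ∫ w, ‖ψ w‖ * ‖u w‖ := by
    rw [← Real.norm_eq_abs, ← Complex.norm_real, ← hval]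
    refine (norm_integral_le_integral_norm _).trans_eq (integral_congr_ae (.of_forall fun w => ?_))
    simp only [norm_mul, hu]
    rw [norm_sum_character_sub]
  have hψu : Integrable fun w => ‖ψ w‖ * ‖u w‖ :=
    ψ.integrable.norm.mul_bdd (c := ∑ i, |b i|)
      (continuous_sum_character a b).norm.aestronglyMeasurable
      (.of_forall fun w => by rw [norm_norm]; exact norm_sum_character_le a b w)
  have hmono : ∫ w, 2 * |b i₀| * (‖ψ w‖ * ‖u w‖)
      ≤ ∫ w, (M * (s w * ‖u w‖ ^ 2) + b i₀ ^ 2 / M * G w) := by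
    refine integral_mono_ae (hψu.const_mul _) ((hQ.const_mul _).add (hG.const_mul _)) ?_
    filter_upwards [hC] with w ⟨hsw, hw⟩
    refine two_mul_abs_mul_le hM hsw (b i₀) ?_
    rw [hGdef]
    simp only [← mul_assoc]
    exact mul_le_mul_of_nonneg_right hw (sq_nonneg _)
  rw [integral_const_mul, integral_add (hQ.const_mul _) (hG.const_mul _), integral_const_mul,
    integral_const_mul] at hmono
  have hGM : b i₀ ^ 2 / M * ∫ w, G w ≤ b i₀ ^ 2 := by
    have : ∫ w, G w ≤ M := (le_abs_self _).trans (by simp [M])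
    calc b i₀ ^ 2 / M * ∫ w, G w ≤ b i₀ ^ 2 / M * M := by gcongr
      _ = b i₀ ^ 2 := by field_simp
  -- With `Q` the quadratic form, `2 * b i₀ ^ 2 ≤ M * Q + b i₀ ^ 2`.
  have h2 := mul_le_mul_of_nonneg_left hle (show 0 ≤ 2 * |b i₀| by positivity)
  have h3 : 2 * |b i₀| * |b i₀| = 2 * b i₀ ^ 2 := by rw [mul_assoc, ← sq, sq_abs]
  rw [inv_mul_le_iff₀ hM]
  linarith

end Spectral

/-! ### Posterior variance as a least residual variance -/

section PosteriorVariance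

variable {Y : Type*}

/-- The variance of `ξ z - ∑ t ∈ T, c t * ξ t` for a centred process with covariance `K`. -/
def residualVariance (K : Y → Y → ℝ) (z : Y) (T : Finset Y) (c : T → ℝ) : ℝ :=
  K z z - 2 * ∑ t, c t * K z t + ∑ t, ∑ t', c t * c t' * K t t'

lemma sum_sum_mul_eq_dotProduct (K : Y → Y → ℝ) (T : Finset Y) (c : T → ℝ) :
    ∑ t, ∑ t', c t * c t' * K t t' = c ⬝ᵥ (Matrix.of fun i j : T => K i j).mulVec c := by
  simp only [dotProduct, Matrix.mulVec, Matrix.of_apply, Finset.mul_sum]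
  exact Finset.sum_congr rfl fun t _ => Finset.sum_congr rfl fun t' _ => by ring

/-- Completing the square around the kriging weights `A⁻¹ v`. -/
lemma residualVariance_eq_add {K : Y → Y → ℝ} (hsymm : ∀ x y, K x y = K y x) (z : Y)
    {T : Finset Y} (hT : (Matrix.of fun i j : T => K i j).PosDef) :
    ∃ c₀ : T → ℝ, ∀ c : T → ℝ, residualVariance K z T c = posteriorVarianceFinset K z T +
      (c - c₀) ⬝ᵥ (Matrix.of fun i j : T => K i j).mulVec (c - c₀) := by
  classical
  set A := Matrix.of fun i j : T => K i j with hA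
  set v : T → ℝ := fun i => K i z with hv
  have hv' : (fun i : T => K z i) = v := funext fun i => hsymm z i
  have hdet : IsUnit A.det := (Matrix.isUnit_iff_isUnit_det A).1 hT.isUnit
  have hAt : A.transpose = A := by ext i j; exact hsymm _ _
  have hAv : A.mulVec (A⁻¹.mulVec v) = v := by
    rw [Matrix.mulVec_mulVec, Matrix.mul_nonsing_inv A hdet, Matrix.one_mulVec]
  have hpost : posteriorVarianceFinset K z T = K z z - v ⬝ᵥ A⁻¹.mulVec v := by
    unfold posteriorVarianceFinset
    rw [hv']
  refine ⟨A⁻¹.mulVec v, fun c => ?_⟩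
  have hlin : ∑ t, c t * K z t = c ⬝ᵥ v := by
    rw [← hv']
    rfl
  have hcross : A⁻¹.mulVec v ⬝ᵥ A.mulVec c = v ⬝ᵥ c := by
    rw [Matrix.dotProduct_mulVec, ← Matrix.mulVec_transpose, hAt, hAv]
  rw [residualVariance, sum_sum_mul_eq_dotProduct, hlin, hpost, Matrix.mulVec_sub,
    sub_dotProduct, dotProduct_sub, dotProduct_sub, hAv, hcross, dotProduct_comm v c,
    dotProduct_comm (A⁻¹.mulVec v) v, hA]
  ring

lemma posteriorVarianceFinset_le_residualVariance {K : Y → Y → ℝ} (hsymm : ∀ x y, K x y = K y x)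
    (z : Y) {T : Finset Y} (hT : (Matrix.of fun i j : T => K i j).PosDef) (c : T → ℝ) :
    posteriorVarianceFinset K z T ≤ residualVariance K z T c := by
  obtain ⟨c₀, hc⟩ := residualVariance_eq_add hsymm z hT
  have hc := hc c
  have := hT.posSemidef.dotProduct_mulVec_nonneg (c - c₀)
  rw [star_trivial] at this
  linarith

lemma exists_residualVariance_eq_posteriorVarianceFinset {K : Y → Y → ℝ}
    (hsymm : ∀ x y, K x y = K y x) (z : Y) {T : Finset Y}
    (hT : (Matrix.of fun i j : T => K i j).PosDef) :
    ∃ c : T → ℝ, residualVariance K z T c = posteriorVarianceFinset K z T := by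
  obtain ⟨c₀, hc⟩ := residualVariance_eq_add hsymm z hT
  exact ⟨c₀, by simp [hc c₀]⟩

/-- The index `none` stands for `z`, with coefficient `1`. -/
lemma residualVariance_eq_sum_sum {K : Y → Y → ℝ} (hsymm : ∀ x y, K x y = K y x) (z : Y)
    (T : Finset Y) (c : T → ℝ) :
    residualVariance K z T c = ∑ i : Option T, ∑ j : Option T,
      i.elim 1 (fun t => -c t) * j.elim 1 (fun t => -c t) *
        K (i.elim z (fun t => t)) (j.elim z (fun t => t)) := by
  simp only [Fintype.sum_option, Option.elim, residualVariance, Finset.sum_add_distrib]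
  simp only [hsymm _ z, one_mul, mul_one, neg_mul, mul_neg, neg_neg, Finset.sum_neg_distrib]
  ring

lemma inputs_evalPairs_union (f : Y → ℝ) (S S' : Set Y) :
    inputs (evalPairs f S ∪ evalPairs f S') = S ∪ S' := by
  simp [inputs, evalPairs, Set.image_union, Set.image_image]

/-- A lower bound over all finite sets of inputs is a lower bound of the posterior variance. -/
lemma le_posteriorVariance {K : Y → Y → ℝ} {x : Y} {D : Set (Y × ℝ)} {δ : ℝ}
    (h : ∀ T : Finset Y, (T : Set Y) ⊆ inputs D → δ ≤ posteriorVarianceFinset K x T) :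
    δ ≤ posteriorVariance K x D := by
  unfold posteriorVariance
  split_ifs with hD
  · exact h _ (by simp)
  · have : Nonempty {T : Finset Y // (T : Set Y) ⊆ inputs D} := ⟨∅, by simp⟩
    exact le_ciInf fun T => h _ T.2

lemma posteriorVariance_le_of_forall_le {K : Y → Y → ℝ} {x y : Y} {D : Set (Y × ℝ)} {b : ℝ}
    (hy : y ∈ inputs D) (hnonneg : ∀ T : Finset Y, 0 ≤ posteriorVarianceFinset K x T)
    (h : ∀ T : Finset Y, y ∈ T → posteriorVarianceFinset K x T ≤ b) :
    posteriorVariance K x D ≤ b := by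
  unfold posteriorVariance
  split_ifs with hD
  · exact h _ (by simpa using hy)
  · exact (ciInf_le ⟨0, by rintro _ ⟨T, rfl⟩; exact hnonneg T.1⟩ ⟨{y}, by simpa using hy⟩).trans
      (h _ (by simp))

end PosteriorVariance

/-! ### Stationary covariances and the GNEB property -/

section Stationary

variable {d : ℕ} {X : Set (EuclideanSpace ℝ (Fin d))} {K : X → X → ℝ}
  {k s : EuclideanSpace ℝ (Fin d) → ℝ}

lemma IsSpectralDensity.posDef_covariance (hs : IsSpectralDensity k s)
    (hgrowth : InvPolynomialGrowth s) (hstat : ∀ x y : X, K x y = k (x.1 - y.1))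
    (hsymm : ∀ x y, K x y = K y x) (T : Finset X) :
    (Matrix.of fun i j : T => K i j).PosDef := by
  refine .of_dotProduct_mulVec_pos (by ext i j; exact hsymm _ _) fun {c} hc => ?_
  obtain ⟨i₀, hi₀⟩ := Function.ne_iff.1 hc
  -- Finitely many distinct points have a positive separation.
  obtain ⟨ρ, hρ, hsep⟩ : ∃ ρ > 0, ∀ i : T, i ≠ i₀ → ρ ≤ dist (i : X).1 (i₀ : X).1 := by
    have hev : ∀ᶠ ρ in 𝓝[>] (0 : ℝ), ∀ i : T, i ≠ i₀ → ρ ≤ dist (i : X).1 (i₀ : X).1 := by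
      refine eventually_all.2 fun i => ?_
      by_cases hi : i = i₀
      · exact .of_forall fun _ h => absurd hi h
      · have hd : 0 < dist (i : X).1 (i₀ : X).1 :=
          dist_pos.2 fun h => hi (Subtype.ext (Subtype.ext h))
        filter_upwards [Ioo_mem_nhdsGT hd] with ρ hρ _ using hρ.2.le
    exact (eventually_mem_nhdsWithin.and hev).exists
  obtain ⟨δ, hδ, h⟩ := hs.exists_mul_sq_le_sum_sum hgrowth hρ
  have h1 := h T (fun i => (i : X).1) c i₀ hsep
  simp only [← hstat] at h1
  rw [sum_sum_mul_eq_dotProduct] at h1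
  rw [star_trivial]
  exact (mul_pos hδ (pow_pos (abs_pos.2 hi₀) 2 |>.trans_eq (sq_abs _))).trans_le h1

lemma IsSpectralDensity.exists_le_posteriorVarianceFinset (hs : IsSpectralDensity k s)
    (hgrowth : InvPolynomialGrowth s) (hstat : ∀ x y : X, K x y = k (x.1 - y.1))
    (hsymm : ∀ x y, K x y = K y x) {ρ : ℝ} (hρ : 0 < ρ) :
    ∃ δ > 0, ∀ (z : X) (T : Finset X), (∀ t ∈ T, ρ ≤ dist z t) →
      δ ≤ posteriorVarianceFinset K z T := by
  obtain ⟨δ, hδ, h⟩ := hs.exists_mul_sq_le_sum_sum hgrowth hρ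
  refine ⟨δ, hδ, fun z T hT => ?_⟩
  obtain ⟨c, hc⟩ := exists_residualVariance_eq_posteriorVarianceFinset hsymm z
    (hs.posDef_covariance hgrowth hstat hsymm T)
  rw [← hc, residualVariance_eq_sum_sum hsymm]
  have h1 := h (Option T) (fun i => (i.elim z (fun t => t) : X).1)
    (fun i => i.elim 1 (fun t => -c t)) none fun i hi => by
      obtain ⟨t, rfl⟩ := Option.ne_none_iff_exists'.1 hi
      rw [dist_comm]
      exact hT t t.2
  simpa only [← hstat, Option.elim_none, one_pow, mul_one] using h1

lemma IsSpectralDensity.posteriorVarianceFinset_nonneg (hs : IsSpectralDensity k s)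
    (hgrowth : InvPolynomialGrowth s) (hstat : ∀ x y : X, K x y = k (x.1 - y.1))
    (hsymm : ∀ x y, K x y = K y x) (z : X) (T : Finset X) :
    0 ≤ posteriorVarianceFinset K z T := by
  obtain ⟨c, hc⟩ := exists_residualVariance_eq_posteriorVarianceFinset hsymm z
    (hs.posDef_covariance hgrowth hstat hsymm T)
  rw [← hc, residualVariance_eq_sum_sum hsymm]
  simp only [hstat]
  -- `z` may lie in `T`; the integral formula allows repeated nodes.
  rw [hs.sum_sum_eq_integral (fun i : Option T => (i.elim z (fun t => t) : X).1)
    (fun i => i.elim 1 (fun t => -c t))]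
  refine integral_nonneg_of_ae ?_
  filter_upwards [hs.nonneg] with w hw
  exact mul_nonneg hw (sq_nonneg _)

lemma IsSpectralDensity.posteriorVarianceFinset_le_of_mem (hs : IsSpectralDensity k s)
    (hgrowth : InvPolynomialGrowth s) (hstat : ∀ x y : X, K x y = k (x.1 - y.1))
    (hsymm : ∀ x y, K x y = K y x) (z : X) {y : X} {T : Finset X} (hy : y ∈ T) :
    posteriorVarianceFinset K z T ≤ K z z - 2 * K z y + K y y := by
  classical
  refine (posteriorVarianceFinset_le_residualVariance hsymm z
    (hs.posDef_covariance hgrowth hstat hsymm T) (Pi.single ⟨y, hy⟩ 1)).trans_eq ?_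
  simp [residualVariance, Pi.single_apply, ite_mul]

/-- The posterior variance of a process with a continuous stationary covariance, whose spectral
density does not decay faster than polynomially, has the no-empty-ball property for any labels. -/
theorem IsSpectralDensity.isGNEB_posteriorVariance (hs : IsSpectralDensity k s)
    (hgrowth : InvPolynomialGrowth s) (hstat : ∀ x y : X, K x y = k (x.1 - y.1))
    (hsymm : ∀ x y, K x y = K y x) (hK : Continuous fun p : X × X => K p.1 p.2) (f : X → ℝ) :
    IsGNEB f (posteriorVariance K) where
  pos_away z x S hpos := by
    -- The separation radius is the infimum of the distances, so `δ` does not depend on `n`.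
    obtain ⟨δ, hδ, h⟩ := hs.exists_le_posteriorVarianceFinset hgrowth hstat hsymm hpos
    refine (EReal.coe_pos.2 hδ).trans_le (le_liminf_of_le (by isBoundedDefault)
      (.of_forall fun n => EReal.coe_le_coe_iff.2 (le_posteriorVariance fun T hT => ?_)))
    rw [inputs_evalPairs_union] at hT
    refine h z T fun t ht => le_trans ?_ (Metric.infDist_le_dist_of_mem (hT ht))
    exact ciInf_le ⟨0, by rintro _ ⟨m, rfl⟩; exact Metric.infDist_nonneg⟩ n
  vanish x x' S hx := by
    have hx1 : Tendsto (fun n => x (n + 1)) atTop (𝓝 x') := (tendsto_add_atTop_iff_nat 1).2 hx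
    have hlim {a b : ℕ → X} (ha : Tendsto a atTop (𝓝 x')) (hb : Tendsto b atTop (𝓝 x')) :
        Tendsto (fun n => K (a n) (b n)) atTop (𝓝 (K x' x')) :=
      (hK.tendsto (x', x')).comp (ha.prodMk_nhds hb)
    have hbound : Tendsto
        (fun n => K (x (n + 1)) (x (n + 1)) - 2 * K (x (n + 1)) (x n) + K (x n) (x n))
        atTop (𝓝 0) := by
      have := ((hlim hx1 hx1).sub ((hlim hx1 hx).const_mul 2)).add (hlim hx hx)
      rwa [show K x' x' - 2 * K x' x' + K x' x' = 0 by ring] at this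
    refine squeeze_zero
      (fun n => le_posteriorVariance fun T _ =>
        hs.posteriorVarianceFinset_nonneg hgrowth hstat hsymm _ T)
      (fun n => posteriorVariance_le_of_forall_le (y := x n) ?_
        (hs.posteriorVarianceFinset_nonneg hgrowth hstat hsymm _)
        fun T hT => hs.posteriorVarianceFinset_le_of_mem hgrowth hstat hsymm _ hT) hbound
    rw [inputs_evalPairs_union]
    -- `Set.Iic n` contains `n`, so `x n` is already observed when `x (n + 1)` is queried.
    exact .inr ⟨n, Set.mem_Iic.2 le_rfl, rfl⟩

end Stationary

end PseudoBO

theorem mainTheorem11 {d : ℕ} (X : Set (EuclideanSpace ℝ (Fin d)))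
    {Ω : Type*} [MeasurableSpace Ω] (P : Measure Ω) [IsProbabilityMeasure P]
    (ξ : X → Ω → ℝ) (m : X → ℝ) (K : X → X → ℝ) (hGP : PseudoBO.IsGP ξ m K P)
    (hK : Continuous fun p : X × X => K p.1 p.2)
    (k : EuclideanSpace ℝ (Fin d) → ℝ) (hstat : ∀ x y : X, K x y = k (x.1 - y.1))
    (s : EuclideanSpace ℝ (Fin d) → ℝ) (hs : PseudoBO.IsSpectralDensity k s)
    (hgrowth : PseudoBO.InvPolynomialGrowth s) :
    ∀ ω : Ω, PseudoBO.IsGNEB (fun x => ξ x ω) (PseudoBO.posteriorVariance K) := fun ω =>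
  hs.isGNEB_posteriorVariance hgrowth hstat
    (fun x y => by rw [← hGP.covariance, ← hGP.covariance, covariance_comm]) hK _
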